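/- \textbf{Theorem.} Let $P$ be a Borel probability measure on $\mathbb{R}$ with properly disconnected support. Then for every probability space $(\Omega,\mathcal{A},\mathbb{P})$ there is no straight-line process on it connecting $P$ to itself: $\mathcal{S}_{\mathrm{SL}}(P,P)=\emptyset$. Here the terms have the following meaning. \emph{Properly disconnected support}: there are bounded open sets $S_0,S_1\subseteq\mathbb{R}$ with disjoint closed convex hulls such that $\operatorname{supp}(P)=\overline{S_0}\cup\overline{S_1}$, $P(S_0)>0$, $P(S_1)>0$, and $P(A)>0$ for every Borel set $A\subseteq S_i$ ($i\in\{0,1\}$) of positive Lebesgue measure. \emph{Straight-line process}: $\mathcal{S}_{\mathrm{SL}}(P_0,P_1)$ is the class of real-valued stochastic processes $X=(X_t)_{t\in[0,1]}$ on $(\Omega,\mathcal{A},\mathbb{P})$ such that 1. almost every sample path $t\mapsto X_t(\omega)$ is continuous on $[0,1]$, and $(X_0,X_1)\sim P_0\otimes P_1$ (independent endpoints); 2. the velocity $\dot X_t(\omega)=\frac{d}{dt}X_t(\omega)$ makes sense: almost every sample path is locally absolutely continuous on $(0,1)$, and for every compact $K\subseteq(0,1)\times\mathbb{R}$ the function $(t,\omega)\mapsto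 \mathbf{1}_{\{(t,X_t(\omega))\in K\}}\,\dot X_t(\omega)$ is integrable with respect to $dt\otimes\mathbb{P}$; 3. the conditional velocity $v(t,x)=\mathbb{E}[\dot X_t\mid X_t=x]$ (the integral against the conditional law of $\dot X_t$ given $X_t=x$, which is required to converge absolutely, for a.e. $t$ and $\mathrm{Law}(X_t)$-a.e. $x$) has a version $v:[0,1]\times\mathbb{R}\to\mathbb{R}$ that is measurable in $(t,x)$, satisfies $|v(t,x)-v(t,y)|\le L\,|x-y|$ for some $L>0$ and all $t\in[0,1]$, $x,y\in\mathbb{R}$, and has a flow map $\phi:[0,1]\times\mathbb{R}\to\mathbb{R}$, $$\partial_t\phi(t,x)=v(t,\phi(t,x)),\qquad \phi(0,x)=x,$$ with $\partial_t^2\phi(t,x)=0$ for all $(t,x)\in[0,1]\times\mathbb{R}$. -/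

import Mathlib

open Set Filter Topology MeasureTheory ProbabilityTheory

/-- `P` has properly disconnected support: `supp P` is the union of the closures of two bounded
open sets with disjoint closed convex hulls, each charged by `P`, and `P` charges every Borel
subset of them of positive Lebesgue measure. -/
def HasProperlyDisconnectedSupport (P : Measure ℝ) : Prop :=
  ∃ S : Fin 2 → Set ℝ,
    (∀ i, IsOpen (S i) ∧ Bornology.IsBounded (S i)) ∧
    Disjoint (closedConvexHull ℝ (S 0)) (closedConvexHull ℝ (S 1)) ∧
    P.support = closure (S 0) ∪ closure (S 1) ∧
    (∀ i, 0 < P (S i)) ∧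
    ∀ i, ∀ A ⊆ S i, MeasurableSet A → 0 < volume A → 0 < P A

section

variable {Ω : Type*} [MeasurableSpace Ω]

/-- The class `𝒮(P₀, P₁)`: real stochastic processes `(X_t)`, `t ∈ [0,1]`, on `(Ω, μ)` with a.s.
continuous sample paths and `(X_0, X_1) ∼ P₀ ⊗ P₁`. Only the values `X t` with `t ∈ [0,1]` matter,
here and below. -/
def independentEndpointProcesses (μ : Measure Ω) (P₀ P₁ : Measure ℝ) : Set (ℝ → Ω → ℝ) :=
  {X | (∀ t ∈ Icc (0 : ℝ) 1, Measurable (X t)) ∧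
    (∀ᵐ ω ∂μ, ContinuousOn (fun t => X t ω) (Icc 0 1)) ∧
    μ.map (fun ω => (X 0 ω, X 1 ω)) = P₀.prod P₁}

/-- The pathwise velocity `Ẋ_t(ω)`. -/
noncomputable def pathVelocity (X : ℝ → Ω → ℝ) (t : ℝ) (ω : Ω) : ℝ :=
  deriv (fun s => X s ω) t

/-- The velocity `Ẋ` makes sense: almost every path is locally absolutely continuous on `(0,1)`
(so that `Ẋ_t` is at once its a.e. and its weak derivative), and `Ẋ`, as a function on
time `×` probability space, is integrable over `{(t, ω) : (t, X_t(ω)) ∈ K}` for all compact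
`K ⊆ (0,1) × ℝ`. -/
def HasIntegrableVelocity (μ : Measure Ω) (X : ℝ → Ω → ℝ) : Prop :=
  (∀ᵐ ω ∂μ, ∀ a b : ℝ, 0 < a → a ≤ b → b < 1 →
    AbsolutelyContinuousOnInterval (fun t => X t ω) a b) ∧
  ∀ a b R : ℝ, 0 < a → a ≤ b → b < 1 →
    Integrable
      ({p : ℝ × Ω | |X p.1 p.2| ≤ R}.indicator (fun p => pathVelocity X p.1 p.2))
      ((volume.restrict (Icc a b)).prod μ)

/-- `v(t, x) = 𝔼[Ẋ_t | X_t = x]` for a.e. `t ∈ [0,1]` and `Law(X_t)`-a.e. `x`, the conditional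
expectation being the (absolutely convergent) integral against the conditional law of `Ẋ_t` given
`X_t = x`. -/
def IsConditionalVelocity (μ : Measure Ω) [IsProbabilityMeasure μ] (X : ℝ → Ω → ℝ)
    (v : ℝ → ℝ → ℝ) : Prop :=
  ∀ᵐ t ∂(volume.restrict (Icc (0 : ℝ) 1)), ∀ᵐ x ∂(μ.map (X t)),
    Integrable (fun y : ℝ => y) (condDistrib (pathVelocity X t) (X t) μ x) ∧
    v t x = ∫ y, y ∂(condDistrib (pathVelocity X t) (X t) μ x)

/-- `φ` is the flow map of `v` on `[0,1] × ℝ`: `∂_t φ(t,x) = v(t, φ(t,x))`, `φ(0,x) = x`. -/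
def IsFlowMap (v φ : ℝ → ℝ → ℝ) : Prop :=
  ∀ x, φ 0 x = x ∧ ∀ t ∈ Icc (0 : ℝ) 1,
    HasDerivWithinAt (fun s => φ s x) (v t (φ t x)) (Icc 0 1) t

/-- `∂_t² φ(t,x) = 0` for all `(t,x) ∈ [0,1] × ℝ`. -/
def HasNoAcceleration (φ : ℝ → ℝ → ℝ) : Prop :=
  ∀ x, ∀ t ∈ Icc (0 : ℝ) 1,
    HasDerivWithinAt (fun s => derivWithin (fun r => φ r x) (Icc 0 1) s) 0 (Icc 0 1) t

/-- The class `𝒮_SL(P₀, P₁)` of straight-line processes connecting `P₀` and `P₁` on `(Ω, μ)`.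
The conditional velocity is determined only up to null sets, so a process belongs to the class
as soon as some version `v` of it has the required properties. -/
def straightLineProcesses (μ : Measure Ω) [IsProbabilityMeasure μ] (P₀ P₁ : Measure ℝ) :
    Set (ℝ → Ω → ℝ) :=
  {X | X ∈ independentEndpointProcesses μ P₀ P₁ ∧ HasIntegrableVelocity μ X ∧
    ∃ v : ℝ → ℝ → ℝ,
      IsConditionalVelocity μ X v ∧
      Measurable (fun p : Icc (0 : ℝ) 1 × ℝ => v p.1 p.2) ∧
      (∃ L : ℝ, 0 < L ∧ ∀ t ∈ Icc (0 : ℝ) 1, ∀ x y : ℝ, |v t x - v t y| ≤ L * |x - y|) ∧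
      ∃ φ : ℝ → ℝ → ℝ, IsFlowMap v φ ∧ HasNoAcceleration φ}

end

/-! Without acceleration the flow is `x ↦ x + t * w x` with `w = v 0`, and `v` is constant along
these lines. The Lipschitz bound keeps the lines uniformly apart (`slope_lower_bound`), so each
`X_t` carries a label `Y_t = ψ t (X_t)`, the starting point of the line through it, with `X_t = Y_t
+ t * w (Y_t)`.

The crux is that the law of `Y_t` does not depend on `t` (`integral_observable_label_eq`). By the
chain rule, the derivative of `g (Y_t)` is a function of `X_t` times `Ẋ_t - w (Y_t)`, and `w (Y_t) =
v t (X_t)` is the conditional mean of `Ẋ_t`, so the expectation vanishes.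

Hence `Y_1` and `X_1` both have law `P`, and the increasing map `x ↦ x + w x` transports `P` to
itself. In one dimension this forces it to fix the support (`eq_of_map_eq_self`), so `w = 0` there
and `X_t = Y_t` stays in `supp P` almost surely. Continuous paths then cannot pass between the two
pieces, while independent endpoints require this with probability at least `P (S 0) * P (S 1) > 0`.
-/

/-! ### Geometry of the straight-line flow. -/

theorem flowMap_eq_straight_line {v φ : ℝ → ℝ → ℝ} (hφ : IsFlowMap v φ)
    (hacc : HasNoAcceleration φ) (x : ℝ) {t : ℝ} (ht : t ∈ Icc (0 : ℝ) 1) :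
    φ t x = x + t * v 0 x ∧ v t (x + t * v 0 x) = v 0 x := by
  have h0 : (0 : ℝ) ∈ Icc (0 : ℝ) 1 := by simp
  have huniq : UniqueDiffOn ℝ (Icc (0 : ℝ) 1) := uniqueDiffOn_Icc zero_lt_one
  have hd : ∀ s ∈ Icc (0 : ℝ) 1, derivWithin (fun r => φ r x) (Icc 0 1) s = v s (φ s x) :=
    fun s hs => ((hφ x).2 s hs).derivWithin (huniq s hs)
  have hconst : ∀ s ∈ Icc (0 : ℝ) 1, v s (φ s x) = v 0 x := by
    intro s hs
    have := constant_of_derivWithin_zero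
      (f := fun s => derivWithin (fun r => φ r x) (Icc 0 1) s) (a := 0) (b := 1)
      (fun r hr => (hacc x r hr).differentiableWithinAt)
      (fun r hr => (hacc x r (Ico_subset_Icc_self hr)).derivWithin
        (huniq r (Ico_subset_Icc_self hr))) s hs
    simp only [hd s hs, hd 0 h0, (hφ x).1] at this
    exact this
  have hline : ∀ s ∈ Icc (0 : ℝ) 1, φ s x = x + s * v 0 x := by
    intro s hs
    have hder : ∀ r ∈ Icc (0 : ℝ) 1,
        HasDerivWithinAt (fun r => φ r x - r * v 0 x) 0 (Icc 0 1) r := by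
      intro r hr
      have h1 := ((hφ x).2 r hr).sub (((hasDerivAt_id r).mul_const (v 0 x)).hasDerivWithinAt)
      rw [hconst r hr, one_mul, sub_self] at h1
      exact h1
    have := constant_of_derivWithin_zero (a := 0) (b := 1)
      (fun r hr => (hder r hr).differentiableWithinAt)
      (fun r hr => (hder r (Ico_subset_Icc_self hr)).derivWithin
        (huniq r (Ico_subset_Icc_self hr))) s hs
    simp only [(hφ x).1] at this
    linarith
  exact ⟨hline t ht, by rw [← hline t ht]; exact hconst t ht⟩

/-- If `v` is `L`-Lipschitz in space and constant along the lines `t ↦ x + t w x`, then these lines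
spread apart at a linear rate. -/
theorem slope_lower_bound {v : ℝ → ℝ → ℝ} {w : ℝ → ℝ} {L : ℝ} (hL : 0 < L)
    (hLip : ∀ t ∈ Icc (0 : ℝ) 1, ∀ x y : ℝ, |v t x - v t y| ≤ L * |x - y|)
    (hw : ∀ t ∈ Icc (0 : ℝ) 1, ∀ x, v t (x + t * w x) = w x)
    {t : ℝ} (ht : t ∈ Icc (0 : ℝ) 1) {x y : ℝ} (hxy : x ≤ y) :
    (1 + L)⁻¹ * (y - x) ≤ (y + t * w y) - (x + t * w x) := by
  have key : ∀ s ∈ Icc (0 : ℝ) 1, |w y - w x| ≤ L * |(y - x) + s * (w y - w x)| := by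
    intro s hs
    have := hLip s hs (y + s * w y) (x + s * w x)
    rw [hw s hs, hw s hs] at this
    convert this using 3
    ring
  obtain ⟨ht0, ht1⟩ := ht
  set d := y - x
  set e := w y - w x
  have hd : 0 ≤ d := sub_nonneg.2 hxy
  have hgoal : (y + t * w y) - (x + t * w x) = d + t * e := by ring
  rw [hgoal]
  have hinv : (1 + L)⁻¹ * d ≤ d := by
    apply mul_le_of_le_one_left hd
    exact inv_le_one_of_one_le₀ (by linarith)
  rcases le_or_gt 0 e with he | he
  · nlinarith [mul_nonneg ht0 he]
  -- Otherwise the two lines meet at time `-d / e`, where the Lipschitz bound makes their velocities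
  -- equal, contradicting `e < 0`.
  have hpos : 0 < d + e := by
    by_contra hcon
    push Not at hcon
    have hs : -d / e ∈ Icc (0 : ℝ) 1 :=
      ⟨div_nonneg_of_nonpos (by linarith) he.le, by rw [div_le_one_of_neg he]; linarith⟩
    have := key _ hs
    rw [div_mul_cancel₀ _ he.ne] at this
    simp at this
    exact he.ne this
  -- At time 1 this reads `-e ≤ L * (d + e)`, that is `d ≤ (1 + L) * (d + e)`. Since `e < 0`, the
  -- gap is smallest at time 1.
  have h1 := key 1 (by simp)
  rw [one_mul, abs_of_neg he, abs_of_pos hpos] at h1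
  have h2 : (1 + L)⁻¹ * d ≤ d + e := by
    rw [inv_mul_le_iff₀ (by linarith)]
    linarith
  nlinarith

/-- Spatial inverse of the straight-line flow `x ↦ x + t w x`, with time clamped to `[0,1]`. -/
theorem exists_continuous_inverse_flow {w : ℝ → ℝ} {c : ℝ} (hc : 0 < c) (hw : Continuous w)
    (hslope : ∀ t ∈ Icc (0 : ℝ) 1, ∀ x y, x ≤ y →
      c * (y - x) ≤ (y + t * w y) - (x + t * w x)) :
    ∃ ψ : ℝ → ℝ → ℝ, Continuous (fun p : ℝ × ℝ => ψ p.1 p.2) ∧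
      ∀ t ∈ Icc (0 : ℝ) 1, ∀ x, ψ t x + t * w (ψ t x) = x := by
  have hsurj : ∀ t ∈ Icc (0 : ℝ) 1, Function.Surjective fun y => y + t * w y := by
    intro t ht
    refine Continuous.surjective (by fun_prop) ?_ ?_
    · refine tendsto_atTop_mono' _ (f₁ := fun y => c * y + (t * w 0)) ?_
        (tendsto_atTop_add_const_right _ _ (tendsto_id.const_mul_atTop hc))
      filter_upwards [eventually_ge_atTop 0] with y hy
      have := hslope t ht 0 y hy
      simp at this
      linarith
    · refine tendsto_atBot_mono' _ (f₁ := fun y => c * y + (t * w 0)) ?_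
        (tendsto_atBot_add_const_right _ _ (tendsto_id.const_mul_atBot hc))
      filter_upwards [eventually_le_atBot 0] with y hy
      have := hslope t ht y 0 hy
      simp at this
      linarith
  let τ : ℝ → ℝ := fun t => projIcc (0 : ℝ) 1 zero_le_one t
  have hτc : Continuous τ := continuous_subtype_val.comp continuous_projIcc
  have hτm : ∀ t, τ t ∈ Icc (0 : ℝ) 1 := fun t => (projIcc (0 : ℝ) 1 zero_le_one t).2
  choose ψ hψ using fun t => hsurj (τ t) (hτm t)
  simp only at hψ
  refine ⟨ψ, ?_, fun t ht x => ?_⟩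
  · rw [continuous_iff_continuousAt]
    rintro ⟨s, x'⟩
    rw [ContinuousAt, tendsto_iff_dist_tendsto_zero]
    -- Both labels are pushed forward to the same time `τ t`: the first lands on `x`, the second on
    -- `x' + (τ t - τ s) * w (ψ s x')`, and `hslope` compares the two.
    have hb : ∀ p : ℝ × ℝ, dist (ψ p.1 p.2) (ψ s x') ≤
        c⁻¹ * (|p.2 - x'| + |τ p.1 - τ s| * |w (ψ s x')|) := by
      rintro ⟨t, x⟩
      have h1 : c * |ψ t x - ψ s x'| ≤
          |(ψ t x + τ t * w (ψ t x)) - (ψ s x' + τ t * w (ψ s x'))| := by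
        rcases le_total (ψ t x) (ψ s x') with h | h
        · rw [abs_sub_comm, abs_sub_comm (ψ t x + _), abs_of_nonneg (sub_nonneg.2 h)]
          exact (hslope _ (hτm t) _ _ h).trans (le_abs_self _)
        · rw [abs_of_nonneg (sub_nonneg.2 h)]
          exact (hslope _ (hτm t) _ _ h).trans (le_abs_self _)
      have h2 : (ψ t x + τ t * w (ψ t x)) - (ψ s x' + τ t * w (ψ s x')) =
          (x - x') - (τ t - τ s) * w (ψ s x') := by
        have := hψ t x
        have := hψ s x'
        linarith
      rw [h2] at h1
      rw [Real.dist_eq, le_inv_mul_iff₀ hc, ← abs_mul]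
      exact h1.trans (abs_sub _ _)
    refine squeeze_zero (fun _ => dist_nonneg) hb ?_
    have : Continuous fun p : ℝ × ℝ =>
        c⁻¹ * (|p.2 - x'| + |τ p.1 - τ s| * |w (ψ s x')|) := by fun_prop
    simpa using this.tendsto (s, x')
  · have : τ t = t := by simp [τ, projIcc_of_mem zero_le_one ht]
    have h := hψ t x
    rwa [this] at h

/-! ### Pathwise calculus for the label when `w` is merely Lipschitz. -/

theorem AbsolutelyContinuousOnInterval.of_dist_le {f x : ℝ → ℝ} {a b A B : ℝ}
    (hx : AbsolutelyContinuousOnInterval x a b)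
    (h : ∀ s ∈ uIcc a b, ∀ t ∈ uIcc a b,
      dist (f s) (f t) ≤ A * dist (x s) (x t) + B * dist s t) :
    AbsolutelyContinuousOnInterval f a b := by
  have hid : AbsolutelyContinuousOnInterval (fun s : ℝ => s) a b :=
    (LipschitzWith.id.lipschitzOnWith (s := uIcc a b)).absolutelyContinuousOnInterval
  have hlim := (Tendsto.const_mul A hx).add (Tendsto.const_mul B hid)
  simp only [mul_zero, add_zero] at hlim
  refine squeeze_zero' (Eventually.of_forall fun E =>
    Finset.sum_nonneg fun _ _ => dist_nonneg) ?_ hlim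
  filter_upwards [mem_inf_of_right (mem_principal_self _)] with E hE
  rw [Finset.mul_sum, Finset.mul_sum, ← Finset.sum_add_distrib]
  exact Finset.sum_le_sum fun i hi => h _ (hE.1 i hi).1 _ (hE.1 i hi).2

/-- Near `t` the path lies strictly below `y t` on the left and strictly above on the right, so by
the intermediate value theorem it covers a neighbourhood of `y t`. Limits at `y t` can therefore be
tested along `y`. -/
theorem nhds_le_map_of_hasDerivAt_pos {y : ℝ → ℝ} {y' t : ℝ} (hy : HasDerivAt y y' t)
    (hy' : 0 < y') (hcont : ∀ᶠ s in 𝓝 t, ContinuousAt y s) : 𝓝 (y t) ≤ map y (𝓝 t) := by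
  intro U hU
  rw [mem_map] at hU
  have hslope := (hasDerivAt_iff_tendsto_slope.1 hy).eventually (eventually_gt_nhds hy')
  rw [eventually_nhdsWithin_iff] at hslope
  obtain ⟨ε, hε, hball⟩ := Metric.eventually_nhds_iff_ball.1
    ((hslope.and hcont).and (eventually_mem_set.2 hU))
  have hsub : Icc (t - ε / 2) (t + ε / 2) ⊆ Metric.ball t ε := by
    intro s hs
    rw [Metric.mem_ball, Real.dist_eq, abs_lt]
    constructor <;> linarith [hs.1, hs.2]
  have hco : ContinuousOn y (Icc (t - ε / 2) (t + ε / 2)) := fun s hs =>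
    (hball s (hsub hs)).1.2.continuousWithinAt
  have hl : y (t - ε / 2) < y t := by
    have := (hball (t - ε / 2) (hsub ⟨le_rfl, by linarith⟩)).1.1
      (by simp only [mem_compl_iff, mem_singleton_iff]; linarith)
    rw [slope_def_field, div_pos_iff] at this
    rcases this with h | h <;> linarith [h.1, h.2]
  have hr : y t < y (t + ε / 2) := by
    have := (hball (t + ε / 2) (hsub ⟨by linarith, le_rfl⟩)).1.1
      (by simp only [mem_compl_iff, mem_singleton_iff]; linarith)
    rw [slope_def_field, div_pos_iff] at this
    rcases this with h | h <;> linarith [h.1, h.2]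
  filter_upwards [Icc_mem_nhds hl hr] with z hz
  obtain ⟨s, hs, rfl⟩ := intermediate_value_Icc (by linarith) hco hz
  exact (hball s (hsub hs)).2

theorem nhds_le_map_of_hasDerivAt_ne_zero {y : ℝ → ℝ} {y' t : ℝ} (hy : HasDerivAt y y' t)
    (hy' : y' ≠ 0) (hcont : ∀ᶠ s in 𝓝 t, ContinuousAt y s) : 𝓝 (y t) ≤ map y (𝓝 t) := by
  rcases hy'.lt_or_gt with h | h
  · have h1 := nhds_le_map_of_hasDerivAt_pos hy.neg (neg_pos.2 h)
      (hcont.mono fun s hs => hs.neg)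
    have h2 := map_mono (m := fun z : ℝ => -z) h1
    rw [map_map] at h2
    have h3 : map (fun z : ℝ => -z) (𝓝 ((-y) t)) = 𝓝 (y t) := by
      have := (Homeomorph.neg ℝ).map_nhds_eq (-y t)
      simpa using this
    rw [h3] at h2
    convert h2 using 2
    ext s
    simp
  · exact nhds_le_map_of_hasDerivAt_pos hy h hcont

/-- A chain rule in reverse: differentiability of `f ∘ y` yields that of `f` wherever `y` moves. -/
theorem HasDerivAt.of_comp_right {f y : ℝ → ℝ} {y' d t : ℝ} (hy : HasDerivAt y y' t)
    (hy' : y' ≠ 0) (hcont : ∀ᶠ s in 𝓝 t, ContinuousAt y s)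
    (hfy : HasDerivAt (fun s => f (y s)) d t) : HasDerivAt f (d / y') (y t) := by
  rw [hasDerivAt_iff_isLittleO]
  refine Asymptotics.IsLittleO.mono ?_ (nhds_le_map_of_hasDerivAt_ne_zero hy hy' hcont)
  rw [Asymptotics.isLittleO_map]
  have h1 := hasDerivAt_iff_isLittleO.1 hfy
  have h2 := (hasDerivAt_iff_isLittleO.1 hy).const_mul_left (d / y')
  have h3 : (fun s => s - t) =O[𝓝 t] fun s => y s - y t := by
    have h4 := (hasDerivAt_iff_isLittleO.1 hy)
    have h5 : (fun s => s - t) =O[𝓝 t] fun s => (s - t) * y' := by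
      refine Asymptotics.IsBigO.of_bound |y'|⁻¹ (Eventually.of_forall fun s => ?_)
      rw [norm_mul, Real.norm_eq_abs y', mul_comm, mul_assoc, mul_inv_cancel₀, mul_one]
      simpa using hy'
    have h6 : (fun s => y s - y t - (s - t) • y') =o[𝓝 t] fun s => (s - t) * y' :=
      h4.trans_isBigO h5
    have h7 := h6.right_isBigO_add
    refine h5.trans (h7.congr_right fun s => ?_)
    simp
  refine ((h1.sub h2).trans_isBigO h3).congr_left fun s => ?_
  simp only [Function.comp, smul_eq_mul]
  field_simp
  ring

/-- The velocity of a path `x s = y s + s w (y s)` in terms of that of its label `y`. -/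
theorem label_velocity {w x y : ℝ → ℝ} {L x' y' t : ℝ} (ht : 0 < t)
    (hLip : ∀ a b, |w a - w b| ≤ L * |a - b|)
    (hxy : ∀ᶠ s in 𝓝 t, x s = y s + s * w (y s))
    (hcont : ∀ᶠ s in 𝓝 t, ContinuousAt y s)
    (hx : HasDerivAt x x' t) (hy : HasDerivAt y y' t) :
    (1 + t * deriv w (y t)) * y' = x' - w (y t) := by
  have hmul : ∀ d, HasDerivAt (fun s => w (y s)) d t → x' = y' + (w (y t) + t * d) := by
    intro d hd
    have h1 := (hy.add ((hasDerivAt_id t).mul hd)).congr_of_eventuallyEq hxy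
    have := hx.unique h1
    simpa using this
  by_cases h0 : y' = 0
  -- Here `w` may fail to be differentiable at `y t`, but the Lipschitz bound still gives `w ∘ y`
  -- derivative 0, and the junk value of `deriv w` is multiplied by 0.
  · subst h0
    have hd : HasDerivAt (fun s => w (y s)) 0 t := by
      rw [hasDerivAt_iff_isLittleO] at hy ⊢
      simp only [smul_zero, sub_zero] at hy ⊢
      refine Asymptotics.IsBigO.trans_isLittleO ?_ hy
      exact Asymptotics.IsBigO.of_bound L (Eventually.of_forall fun s => hLip _ _)
    have := hmul 0 hd
    rw [this]
    ring
  -- Near `t > 0`, `w (y s) = (x s - y s) / s`. Since `y' ≠ 0`, the reverse chain rule then makes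
  -- `w` itself differentiable at `y t`.
  · have hd : ∃ d, HasDerivAt (fun s => w (y s)) d t := by
      refine ⟨_, (((hx.sub hy).div (hasDerivAt_id t) ht.ne')).congr_of_eventuallyEq ?_⟩
      filter_upwards [hxy, eventually_gt_nhds ht] with s hs hs0
      simp only [Pi.div_apply, Pi.sub_apply, hs, id]
      field_simp
      ring
    obtain ⟨d, hd⟩ := hd
    have h1 := hy.of_comp_right h0 hcont hd
    rw [h1.deriv, hmul d hd]
    field_simp
    ring

/-- Where `w` is not differentiable, `deriv w` is 0 and the bound is `c ≤ 1`. The denominator `1 + t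
* deriv w` is thus bounded below at every point, with no exceptional null set. -/
theorem slope_le_one_add_deriv {w : ℝ → ℝ} {c t : ℝ} (hc1 : c ≤ 1)
    (hslope : ∀ x y, x ≤ y → c * (y - x) ≤ (y + t * w y) - (x + t * w x)) (x : ℝ) :
    c ≤ 1 + t * deriv w x := by
  by_cases hd : DifferentiableAt ℝ w x
  · have hmono : Monotone fun y => y + t * w y - c * y := by
      intro a b hab
      have := hslope a b hab
      simp only
      linarith
    have hder := (((hasDerivAt_id x).add (hd.hasDerivAt.const_mul t)).sub
      ((hasDerivAt_id x).const_mul c))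
    have h1 := hder.nonneg_of_monotone hmono
    linarith
  · rw [deriv_zero_of_not_differentiableAt hd]
    simpa using hc1

theorem AbsolutelyContinuousOnInterval.of_label {w x y : ℝ → ℝ} {c a b : ℝ} (hc : 0 < c)
    (hw : Continuous w)
    (hslope : ∀ t ∈ uIcc a b, ∀ x y, x ≤ y → c * (y - x) ≤ (y + t * w y) - (x + t * w x))
    (hxy : ∀ t ∈ uIcc a b, x t = y t + t * w (y t)) (hy : Continuous y)
    (hx : AbsolutelyContinuousOnInterval x a b) : AbsolutelyContinuousOnInterval y a b := by
  obtain ⟨M, hM⟩ := (isCompact_uIcc (a := a) (b := b)).exists_bound_of_continuousOn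
    (f := fun s => w (y s)) (by fun_prop)
  refine hx.of_dist_le (A := c⁻¹) (B := c⁻¹ * M) fun s hs t ht => ?_
  have h1 : c * |y t - y s| ≤ |(y t + t * w (y t)) - (y s + t * w (y s))| := by
    rcases le_total (y t) (y s) with h | h
    · rw [abs_sub_comm, abs_sub_comm (y t + _), abs_of_nonneg (sub_nonneg.2 h)]
      exact (hslope t ht _ _ h).trans (le_abs_self _)
    · rw [abs_of_nonneg (sub_nonneg.2 h)]
      exact (hslope t ht _ _ h).trans (le_abs_self _)
  have h2 : (y t + t * w (y t)) - (y s + t * w (y s)) = (x t - x s) - (t - s) * w (y s) := by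
    rw [hxy t ht, hxy s hs]
    ring
  rw [h2] at h1
  have h3 : c * |y t - y s| ≤ |x t - x s| + M * |t - s| := by
    refine (h1.trans (abs_sub _ _)).trans ?_
    rw [abs_mul, mul_comm M]
    gcongr
    exact hM s hs
  rw [dist_comm, dist_comm (x s), dist_comm s, Real.dist_eq, Real.dist_eq, Real.dist_eq,
    mul_assoc, ← mul_add, le_inv_mul_iff₀ hc]
  exact h3

/-- The increment of an observable of the label `y` of a path `x s = y s + s w (y s)`. -/
theorem integral_label_velocity {w x y g : ℝ → ℝ} {c L a b : ℝ} (hc : 0 < c) (hc1 : c ≤ 1)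
    (ha : 0 < a) (hab : a ≤ b) (hb : b < 1)
    (hLip : ∀ x y, |w x - w y| ≤ L * |x - y|) (hw : Continuous w)
    (hslope : ∀ t ∈ Icc (0 : ℝ) 1, ∀ x y, x ≤ y →
      c * (y - x) ≤ (y + t * w y) - (x + t * w x))
    (hxy : ∀ t ∈ Icc (0 : ℝ) 1, x t = y t + t * w (y t)) (hy : Continuous y)
    (hx : AbsolutelyContinuousOnInterval x a b)
    (hg : ContDiff ℝ 1 g) (hgc : HasCompactSupport g) :
    g (y b) - g (y a) =
      ∫ s in a..b, deriv g (y s) / (1 + s * deriv w (y s)) * (deriv x s - w (y s)) := by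
  have hsub : uIcc a b ⊆ Icc (0 : ℝ) 1 := by
    rw [uIcc_of_le hab]
    exact Icc_subset_Icc ha.le hb.le
  have hyac : AbsolutelyContinuousOnInterval y a b :=
    hx.of_label hc hw (fun t ht => hslope t (hsub ht)) (fun t ht => hxy t (hsub ht)) hy
  -- A Lipschitz `g` keeps `g ∘ y` absolutely continuous, so the fundamental theorem of calculus
  -- applies.
  obtain ⟨K, hK⟩ := hg.lipschitzWith_of_hasCompactSupport hgc one_ne_zero
  have hgy : AbsolutelyContinuousOnInterval (fun s => g (y s)) a b :=
    hyac.of_dist_le (A := K) (B := 0) fun s _ t _ => by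
      simpa using hK.dist_le_mul (y s) (y t)
  rw [← hgy.integral_deriv_eq_sub]
  apply intervalIntegral.integral_congr_ae
  filter_upwards [hx.ae_differentiableAt, hyac.ae_differentiableAt] with s hxs hys hs
  have hs' := uIoc_subset_uIcc hs
  rw [uIcc_of_le hab] at hs'
  have hs0 : 0 < s := ha.trans_le hs'.1
  have hs1 : s < 1 := hs'.2.trans_lt hb
  have hX := (hxs (uIoc_subset_uIcc hs)).hasDerivAt
  have hY := (hys (uIoc_subset_uIcc hs)).hasDerivAt
  have hvel := label_velocity hs0 hLip
    (by filter_upwards [Icc_mem_nhds hs0 hs1] with r hr using hxy r hr)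
    (Eventually.of_forall fun r => hy.continuousAt) hX hY
  have hpos := hc.trans_le (slope_le_one_add_deriv hc1 (hslope s ⟨hs0.le, hs1.le⟩) (y s))
  have hcomp : HasDerivAt (fun s => g (y s)) (deriv g (y s) * deriv y s) s :=
    ((hg.differentiable one_ne_zero) (y s)).hasDerivAt.comp s hY
  rw [hcomp.deriv, ← hvel]
  field_simp

/-! ### Averaging over paths: the law of the label is conserved. -/

/-- The tower property, by disintegrating the joint law of `(Z, V)`. Only the product `k (Z) * V` is
assumed integrable, since the velocity itself is integrable only locally. -/
theorem integral_mul_eq_of_condDistrib {Ω : Type*} [MeasurableSpace Ω] {μ : Measure Ω}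
    [IsProbabilityMeasure μ] {Z V : Ω → ℝ} (hZ : AEMeasurable Z μ) (hV : AEMeasurable V μ)
    {k u : ℝ → ℝ} (hk : Measurable k) (hum : Measurable u)
    (hu : ∀ᵐ x ∂(μ.map Z), u x = ∫ y, y ∂(condDistrib V Z μ x))
    (hint : Integrable (fun ω => k (Z ω) * V ω) μ) :
    ∫ ω, k (Z ω) * V ω ∂μ = ∫ ω, k (Z ω) * u (Z ω) ∂μ := by
  have hm : Measurable fun p : ℝ × ℝ => k p.1 * p.2 := by fun_prop
  have hpair : AEMeasurable (fun ω => (Z ω, V ω)) μ := hZ.prodMk hV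
  have hint' : Integrable (fun p : ℝ × ℝ => k p.1 * p.2) (μ.map fun ω => (Z ω, V ω)) :=
    (integrable_map_measure hm.aestronglyMeasurable hpair).2 hint
  have h1 : ∫ ω, k (Z ω) * V ω ∂μ = ∫ p : ℝ × ℝ, k p.1 * p.2 ∂(μ.map fun ω => (Z ω, V ω)) :=
    (integral_map hpair hm.aestronglyMeasurable).symm
  rw [← compProd_map_condDistrib hV] at h1 hint'
  rw [h1, Measure.integral_compProd hint', ← integral_map (f := fun x => k x * u x) hZ
    (hk.mul hum).aestronglyMeasurable]
  apply integral_congr_ae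
  filter_upwards [hu] with x hx
  rw [hx, integral_const_mul]

/-- A process whose paths are a.s. continuous on `[0,1]` has a modification with continuous paths
on the whole line. -/
theorem exists_continuous_version {Ω : Type*} [MeasurableSpace Ω] {μ : Measure Ω}
    {X : ℝ → Ω → ℝ} (hXm : ∀ t ∈ Icc (0 : ℝ) 1, Measurable (X t))
    (hXc : ∀ᵐ ω ∂μ, ContinuousOn (fun t => X t ω) (Icc 0 1)) :
    ∃ Z : ℝ → Ω → ℝ, (∀ t, Measurable (Z t)) ∧ (∀ ω, Continuous fun t => Z t ω) ∧
      ∀ᵐ ω ∂μ, ∀ t ∈ Icc (0 : ℝ) 1, Z t ω = X t ω := by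
  classical
  obtain ⟨N, hsub, hNm, hN⟩ := exists_measurable_superset_of_null (ae_iff.1 hXc)
  have hmem : ∀ t, (projIcc (0 : ℝ) 1 zero_le_one t : ℝ) ∈ Icc (0 : ℝ) 1 := fun t =>
    (projIcc (0 : ℝ) 1 zero_le_one t).2
  refine ⟨fun t => N.piecewise 0 (X (projIcc (0 : ℝ) 1 zero_le_one t)), fun t => ?_,
    fun ω => ?_, ?_⟩
  · exact Measurable.piecewise hNm measurable_const (hXm _ (hmem t))
  · by_cases hω : ω ∈ N
    · simp only [piecewise_eq_of_mem _ _ _ hω]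
      exact continuous_const
    · simp only [piecewise_eq_of_notMem _ _ _ hω]
      have hc : ContinuousOn (fun t => X t ω) (Icc 0 1) := by
        by_contra hcon
        exact hω (hsub hcon)
      exact hc.comp_continuous (continuous_subtype_val.comp continuous_projIcc) hmem
  · filter_upwards [measure_eq_zero_iff_ae_notMem.1 hN] with ω hω t ht
    rw [piecewise_eq_of_notMem _ _ _ hω, projIcc_of_mem zero_le_one ht]

theorem measurable_label_weight {w g : ℝ → ℝ} :
    Measurable fun p : ℝ × ℝ => deriv g p.2 / (1 + p.1 * deriv w p.2) := by
  have h1 := measurable_deriv g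
  have h2 := measurable_deriv w
  fun_prop

section

variable {Ω : Type*} [MeasurableSpace Ω] {μ : Measure Ω} [IsProbabilityMeasure μ]
  {X : ℝ → Ω → ℝ}

/-- For almost every `t`, all truncations to `|X t| ≤ n` are measurable at once, and at each `ω`
they are eventually equal to the velocity. -/
theorem HasIntegrableVelocity.ae_aemeasurable (hX : HasIntegrableVelocity μ X) {a b : ℝ}
    (ha : 0 < a) (hab : a ≤ b) (hb : b < 1) :
    ∀ᵐ t ∂(volume.restrict (Icc a b)), AEMeasurable (pathVelocity X t) μ := by
  have h := fun n : ℕ => (hX.2 a b n ha hab hb).prod_right_ae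
  rw [← ae_all_iff] at h
  filter_upwards [h] with t ht
  refine aemeasurable_of_tendsto_metrizable_ae atTop (fun n => (ht n).aemeasurable)
    (Eventually.of_forall fun ω => ?_)
  apply tendsto_const_nhds.congr'
  obtain ⟨N, hN⟩ := exists_nat_ge |X t ω|
  filter_upwards [eventually_ge_atTop N] with n hn
  rw [indicator_of_mem]
  exact hN.trans (Nat.cast_le.2 hn)

/-- The velocity of the label of the process averages to zero. -/
theorem integral_observable_label_eq {v ψ : ℝ → ℝ → ℝ} {w g : ℝ → ℝ} {Y : ℝ → Ω → ℝ}
    {c L a b : ℝ} (hc : 0 < c) (hc1 : c ≤ 1) (ha : 0 < a) (hab : a ≤ b) (hb : b < 1)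
    (hLip : ∀ x y, |w x - w y| ≤ L * |x - y|) (hw : Continuous w)
    (hslope : ∀ t ∈ Icc (0 : ℝ) 1, ∀ x y, x ≤ y →
      c * (y - x) ≤ (y + t * w y) - (x + t * w x))
    (hvw : ∀ t ∈ Icc (0 : ℝ) 1, ∀ x, v t (x + t * w x) = w x)
    (hψc : Continuous fun p : ℝ × ℝ => ψ p.1 p.2)
    (hψ : ∀ t ∈ Icc (0 : ℝ) 1, ∀ x, ψ t x + t * w (ψ t x) = x)
    (hXm : ∀ t ∈ Icc (0 : ℝ) 1, Measurable (X t))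
    (hvel : HasIntegrableVelocity μ X) (hcond : IsConditionalVelocity μ X v)
    (hYm : ∀ t, Measurable (Y t)) (hYc : ∀ ω, Continuous fun t => Y t ω)
    (hYX : ∀ᵐ ω ∂μ, ∀ t ∈ Icc (0 : ℝ) 1, Y t ω = ψ t (X t ω))
    (hg : ContDiff ℝ 1 g) (hgc : HasCompactSupport g) :
    ∫ ω, g (Y b ω) ∂μ = ∫ ω, g (Y a ω) ∂μ := by
  have hsub : Icc a b ⊆ Icc (0 : ℝ) 1 := Icc_subset_Icc ha.le hb.le
  let h : ℝ → ℝ → ℝ := fun t y => deriv g y / (1 + t * deriv w y)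
  have hhm : Measurable fun p : ℝ × ℝ => h p.1 p.2 := measurable_label_weight
  have hpos : ∀ t ∈ Icc (0 : ℝ) 1, ∀ y, c ≤ 1 + t * deriv w y := fun t ht y =>
    slope_le_one_add_deriv hc1 (hslope t ht) y
  obtain ⟨G, hG⟩ := hgc.deriv.exists_bound_of_continuous (hg.continuous_deriv le_rfl)
  have hhb : ∀ t ∈ Icc (0 : ℝ) 1, ∀ y, ‖h t y‖ ≤ G / c := by
    intro t ht y
    have hG0 := (norm_nonneg _).trans (hG y)
    rw [norm_div]
    have h1 := hpos t ht y
    rw [Real.norm_of_nonneg (hc.le.trans h1)]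
    exact div_le_div₀ hG0 (hG y) hc h1
  -- The weight vanishes unless `|Y_t| ≤ r`, and there `|X_t| ≤ |Y_t| + t * |w (Y_t)| ≤ r + M`. This
  -- localisation lets the integrability of the velocity over compact sets suffice.
  obtain ⟨r, hr⟩ := hgc.deriv.isCompact.isBounded.subset_closedBall 0
  obtain ⟨M, hM⟩ := (isCompact_closedBall (0 : ℝ) r).exists_bound_of_continuousOn hw.continuousOn
  have hsupp : ∀ t y, h t y ≠ 0 → y ∈ Metric.closedBall (0 : ℝ) r := by
    intro t y hne
    apply hr
    apply subset_tsupport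
    intro h0
    exact hne (by simp [h, h0])
  have hYu : Measurable fun p : ℝ × Ω => Y p.1 p.2 :=
    measurable_uncurry_of_continuous_of_measurable hYc hYm
  let ν := (volume.restrict (Icc a b)).prod μ
  have hνX : ∀ᵐ p ∂ν, p.1 ∈ Icc a b ∧ Y p.1 p.2 = ψ p.1 (X p.1 p.2) := by
    have h1 : ∀ᵐ p ∂ν, p.1 ∈ Icc a b :=
      Measure.quasiMeasurePreserving_fst.ae (ae_restrict_mem measurableSet_Icc)
    have h2 : ∀ᵐ p ∂ν, ∀ t ∈ Icc (0 : ℝ) 1, Y t p.2 = ψ t (X t p.2) :=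
      Measure.quasiMeasurePreserving_snd.ae hYX
    filter_upwards [h1, h2] with p hp hp2 using ⟨hp, hp2 _ (hsub hp)⟩
  have hHm : AEStronglyMeasurable (fun p : ℝ × Ω => h p.1 (Y p.1 p.2)) ν :=
    (hhm.comp (measurable_fst.prodMk hYu)).aestronglyMeasurable
  have hHb : ∀ᵐ p ∂ν, ‖h p.1 (Y p.1 p.2)‖ ≤ G / c := by
    filter_upwards [hνX] with p hp using hhb _ (hsub hp.1) _
  have hint1 : Integrable (fun p : ℝ × Ω => h p.1 (Y p.1 p.2) * pathVelocity X p.1 p.2) ν := by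
    refine ((hvel.2 a b (r + M) ha hab hb).bdd_mul hHm hHb).congr ?_
    filter_upwards [hνX] with p hp
    by_cases h0 : h p.1 (Y p.1 p.2) = 0
    · rw [h0, zero_mul, zero_mul]
    · rw [indicator_of_mem]
      have hmem := hsupp _ _ h0
      have h1 := hψ p.1 (hsub hp.1) (X p.1 p.2)
      rw [← hp.2] at h1
      have h2 := hM _ hmem
      rw [mem_closedBall_zero_iff] at hmem
      change |X p.1 p.2| ≤ r + M
      rw [← h1]
      refine (abs_add_le _ _).trans (add_le_add hmem ?_)
      rw [abs_mul, abs_of_nonneg (hsub hp.1).1]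
      exact (mul_le_of_le_one_left (abs_nonneg _) (hsub hp.1).2).trans h2
  have hint2 : Integrable (fun p : ℝ × Ω => h p.1 (Y p.1 p.2) * w (Y p.1 p.2)) ν := by
    refine Integrable.of_bound (C := |G / c * M|)
      (hHm.mul (hw.measurable.comp hYu).aestronglyMeasurable) ?_
    filter_upwards [hνX] with p hp
    have hG0 := (norm_nonneg _).trans (hhb _ (hsub hp.1) (Y p.1 p.2))
    by_cases h0 : h p.1 (Y p.1 p.2) = 0
    · rw [h0, zero_mul, norm_zero]
      exact abs_nonneg _
    · rw [norm_mul]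
      exact (mul_le_mul (hhb _ (hsub hp.1) _) (hM _ (hsupp _ _ h0)) (norm_nonneg _) hG0).trans
        (le_abs_self _)
  have hint : Integrable (fun p : ℝ × Ω =>
      h p.1 (Y p.1 p.2) * (pathVelocity X p.1 p.2 - w (Y p.1 p.2))) ν := by
    refine (hint1.sub hint2).congr (Eventually.of_forall fun p => ?_)
    simp only [Pi.sub_apply, mul_sub]
  have hpath : ∀ᵐ ω ∂μ, g (Y b ω) - g (Y a ω) =
      ∫ t in Icc a b, h t (Y t ω) * (pathVelocity X t ω - w (Y t ω)) := by
    filter_upwards [hYX, hvel.1] with ω hω hac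
    rw [integral_Icc_eq_integral_Ioc, ← intervalIntegral.integral_of_le hab]
    refine integral_label_velocity hc hc1 ha hab hb hLip hw hslope (x := fun t => X t ω)
      (y := fun t => Y t ω) (fun t ht => ?_) (hYc ω) (hac a b ha hab hb) hg hgc
    rw [hω t ht, hψ t ht]
  -- The weight is a function of `X_t`, so the velocity may be replaced by its conditional mean `v t
  -- (X_t) = w (ψ t (X_t))`, which cancels `w (Y_t)`.
  have hzero : ∀ᵐ t ∂(volume.restrict (Icc a b)),
      ∫ ω, h t (Y t ω) * (pathVelocity X t ω - w (Y t ω)) ∂μ = 0 := by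
    filter_upwards [hvel.ae_aemeasurable ha hab hb, hint1.prod_right_ae, hint2.prod_right_ae,
      ae_restrict_mem measurableSet_Icc,
      ae_mono (Measure.restrict_mono hsub le_rfl) hcond] with t hV hi1 hi2 ht hu
    have ht' := hsub ht
    simp only [mul_sub]
    rw [integral_sub hi1 hi2, sub_eq_zero]
    have hYt : ∀ᵐ ω ∂μ, Y t ω = ψ t (X t ω) := hYX.mono fun ω hω => hω t ht'
    have hψt : Continuous (ψ t) := hψc.comp (by fun_prop : Continuous fun x => (t, x))
    have hvt : ∀ x, v t x = w (ψ t x) := fun x => by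
      rw [← hvw t ht' (ψ t x), hψ t ht']
    have hcongr : (fun ω => h t (Y t ω) * pathVelocity X t ω) =ᵐ[μ]
        fun ω => h t (ψ t (X t ω)) * pathVelocity X t ω := by
      filter_upwards [hYt] with ω hω
      rw [hω]
    rw [integral_congr_ae hcongr, integral_mul_eq_of_condDistrib (Z := X t)
      (V := pathVelocity X t) (k := fun x => h t (ψ t x)) (u := v t) (hXm t ht').aemeasurable hV
      (hhm.comp (measurable_const.prodMk hψt.measurable))
      ((funext hvt : v t = _) ▸ (hw.comp hψt).measurable) (hu.mono fun x hx => hx.2)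
      (hi1.congr hcongr)]
    apply integral_congr_ae
    filter_upwards [hYt] with ω hω
    rw [hω, hvt]
  have hgi : ∀ t, Integrable (fun ω => g (Y t ω)) μ := by
    intro t
    obtain ⟨C, hC⟩ := hgc.exists_bound_of_continuous hg.continuous
    exact Integrable.of_bound (hg.continuous.measurable.comp (hYm t)).aestronglyMeasurable C
      (Eventually.of_forall fun ω => hC _)
  rw [← sub_eq_zero, ← integral_sub (hgi b) (hgi a), integral_congr_ae hpath,
    ← integral_integral_swap hint, integral_congr_ae hzero, integral_zero]

end

/-! ### Identification of laws, rigidity of monotone transport, and path crossings. -/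

/-- If `f` is smooth with values in `[0,1]` and is nonzero exactly on `(a, b)`, then `1 - (1 - f) ^
n` is an admissible test function and converges boundedly to the indicator of `(a, b)`. -/
theorem measure_eq_of_integral_contDiff_eq {P Q : Measure ℝ} [IsProbabilityMeasure P]
    [IsProbabilityMeasure Q]
    (h : ∀ g : ℝ → ℝ, ContDiff ℝ 1 g → HasCompactSupport g → ∫ x, g x ∂P = ∫ x, g x ∂Q) :
    P = Q := by
  refine Real.measure_ext_Ioo_rat fun a b => ?_
  obtain ⟨f, hfs, hf, hf01⟩ :=
    (isOpen_Ioo (a := (a : ℝ)) (b := (b : ℝ))).exists_contDiff_support_eq (n := 1)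
  have hf01' : ∀ x, 0 ≤ f x ∧ f x ≤ 1 := fun x => hf01 (mem_range_self x)
  have hlim : ∀ x, Tendsto (fun n : ℕ => 1 - (1 - f x) ^ n) atTop
      (𝓝 ((Ioo (a : ℝ) b).indicator (fun _ => (1 : ℝ)) x)) := by
    intro x
    by_cases hx : x ∈ Ioo (a : ℝ) b
    · rw [indicator_of_mem hx]
      have hne : f x ≠ 0 := by rwa [← hfs] at hx
      have hpos := (hf01' x).1.lt_of_ne' hne
      simpa using (tendsto_pow_atTop_nhds_zero_of_lt_one (sub_nonneg.2 (hf01' x).2)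
        (by linarith : 1 - f x < 1)).const_sub 1
    · rw [indicator_of_notMem hx]
      have h0 : f x = 0 := by
        rw [← hfs] at hx
        simpa using hx
      simp [h0]
  have hconv : ∀ ρ : Measure ℝ, [IsProbabilityMeasure ρ] →
      Tendsto (fun n : ℕ => ∫ x, (1 - (1 - f x) ^ n) ∂ρ) atTop (𝓝 (ρ.real (Ioo (a : ℝ) b))) := by
    intro ρ _
    rw [← integral_indicator_one measurableSet_Ioo]
    refine tendsto_integral_of_dominated_convergence (fun _ => 1) (fun n => ?_)
      (integrable_const _) (fun n => Eventually.of_forall fun x => ?_)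
      (Eventually.of_forall hlim)
    · have := hf.continuous
      exact (by fun_prop : Continuous fun x => 1 - (1 - f x) ^ n).aestronglyMeasurable
    · have h1 := hf01' x
      have h2 : 0 ≤ (1 - f x) ^ n := pow_nonneg (by linarith) n
      have h3 : (1 - f x) ^ n ≤ 1 := pow_le_one₀ (by linarith) (by linarith)
      rw [Real.norm_of_nonneg (by linarith)]
      linarith
  have heq : ∀ n : ℕ, ∫ x, (1 - (1 - f x) ^ n) ∂P = ∫ x, (1 - (1 - f x) ^ n) ∂Q := by
    intro n
    have hf' : ContDiff ℝ 1 f := hf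
    refine h _ (by fun_prop) ?_
    refine HasCompactSupport.intro' (isCompact_Icc (a := (a : ℝ)) (b := (b : ℝ))) isClosed_Icc
      fun x hx => ?_
    have h0 : f x = 0 := by
      have : x ∉ f.support := by
        rw [hfs]
        exact fun hx' => hx (Ioo_subset_Icc_self hx')
      simpa using this
    simp [h0]
  have := tendsto_nhds_unique (hconv P) ((hconv Q).congr fun n => (heq n).symm)
  exact (measureReal_eq_measureReal_iff).1 this

/-- A strictly increasing transport of `P` to itself fixes all points to the right and to the left
of which `P` has mass. -/
theorem eq_of_map_eq_self {P : Measure ℝ} [IsFiniteMeasure P] {ψ φ : ℝ → ℝ}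
    (hψ : Measurable ψ) (hφ : StrictMono φ) (hφψ : ∀ x, φ (ψ x) = x) (hP : P.map ψ = P)
    {x : ℝ} (hr : ∀ y, x < y → 0 < P (Ioc x y)) (hl : ∀ y, y < x → 0 < P (Ioc y x)) :
    φ x = x := by
  -- Since `φ` is increasing, `ψ z ≤ x` exactly when `z = φ (ψ z) ≤ φ x`. Hence no mass lies between
  -- `x` and `φ x`.
  have hpre : P (Iic (φ x)) = P (Iic x) := by
    conv_rhs => rw [← hP]
    rw [Measure.map_apply hψ measurableSet_Iic]
    congr 1
    ext z
    simp only [mem_Iic, mem_preimage]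
    rw [← hφ.le_iff_le (a := ψ z), hφψ]
  by_contra hne
  rcases lt_or_gt_of_ne hne with h | h
  · have := hl _ h
    rw [← Iic_sdiff_Iic, measure_sdiff (Iic_subset_Iic.2 h.le) measurableSet_Iic.nullMeasurableSet
      (measure_ne_top _ _), hpre, tsub_self] at this
    exact this.false
  · have := hr _ h
    rw [← Iic_sdiff_Iic, measure_sdiff (Iic_subset_Iic.2 h.le) measurableSet_Iic.nullMeasurableSet
      (measure_ne_top _ _), hpre, tsub_self] at this
    exact this.false

/-- A continuous process that has its values at all times in a union of two disjoint closed sets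
cannot move from one to the other. -/
theorem ae_not_crossing_of_mem_union {Ω : Type*} [MeasurableSpace Ω] {μ : Measure Ω}
    {Y : ℝ → Ω → ℝ} (hYc : ∀ ω, Continuous fun t => Y t ω) {A B : Set ℝ} (hA : IsClosed A)
    (hB : IsClosed B) (hAB : Disjoint A B)
    (hmem : ∀ t ∈ Icc (0 : ℝ) 1, ∀ᵐ ω ∂μ, Y t ω ∈ A ∪ B) :
    ∀ᵐ ω ∂μ, ¬ (Y 0 ω ∈ A ∧ Y 1 ω ∈ B) := by
  -- Countably many times share one null set; density and closedness then extend the inclusion to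
  -- all of `[0,1]`.
  have hrat : ∀ᵐ ω ∂μ, ∀ q : ℚ, (q : ℝ) ∈ Ioo (0 : ℝ) 1 → Y q ω ∈ A ∪ B := by
    rw [ae_all_iff]
    intro q
    by_cases hq : (q : ℝ) ∈ Ioo (0 : ℝ) 1
    · filter_upwards [hmem q (Ioo_subset_Icc_self hq)] with ω hω _ using hω
    · exact Eventually.of_forall fun ω h => absurd h hq
  filter_upwards [hrat] with ω hω ⟨h0, h1⟩
  have hall : Icc (0 : ℝ) 1 ⊆ (fun t => Y t ω) ⁻¹' (A ∪ B) := by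
    have hcl : IsClosed ((fun t => Y t ω) ⁻¹' (A ∪ B)) := (hA.union hB).preimage (hYc ω)
    rw [← closure_Ioo (zero_ne_one' ℝ)]
    refine closure_minimal (((Rat.denseRange_cast (𝕜 := ℝ)).open_subset_closure_inter
      isOpen_Ioo).trans (closure_minimal ?_ hcl)) hcl
    rintro _ ⟨ht, q, rfl⟩
    exact hω q ht
  have hpre := (isPreconnected_Icc (a := (0 : ℝ)) (b := 1)).image _ (hYc ω).continuousOn
  obtain ⟨z, -, hzA, hzB⟩ := isPreconnected_closed_iff.1 hpre A B hA hB
    (image_subset_iff.2 hall) ⟨_, ⟨0, by simp, rfl⟩, h0⟩ ⟨_, ⟨1, by simp, rfl⟩, h1⟩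
  exact hAB.notMem_of_mem_left hzA hzB

/-! ### The contradiction. -/

theorem mainTheorem2 (P : Measure ℝ) [IsProbabilityMeasure P]
    (hP : HasProperlyDisconnectedSupport P)
    {Ω : Type*} [MeasurableSpace Ω] (μ : Measure Ω) [IsProbabilityMeasure μ] :
    straightLineProcesses μ P P = ∅ := by
  rw [eq_empty_iff_forall_notMem]
  rintro X ⟨⟨hXm, hXc, hend⟩, hvel, v, hcond, -, ⟨L, hL, hLip⟩, φ, hφ, hacc⟩
  have h0 : (0 : ℝ) ∈ Icc (0 : ℝ) 1 := by simp
  have h1 : (1 : ℝ) ∈ Icc (0 : ℝ) 1 := by simp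
  let w := v 0
  have hwLip : ∀ x y, |w x - w y| ≤ L * |x - y| := hLip 0 h0
  have hw : Continuous w := by
    have : LipschitzWith L.toNNReal w := LipschitzWith.of_dist_le_mul fun x y => by
      simpa [Real.dist_eq, hL.le] using hwLip x y
    exact this.continuous
  have hvw : ∀ t ∈ Icc (0 : ℝ) 1, ∀ x, v t (x + t * w x) = w x := fun t ht x =>
    (flowMap_eq_straight_line hφ hacc x ht).2
  have hc : 0 < (1 + L)⁻¹ := by positivity
  have hc1 : (1 + L)⁻¹ ≤ 1 := inv_le_one_of_one_le₀ (by linarith)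
  have hslope : ∀ t ∈ Icc (0 : ℝ) 1, ∀ x y, x ≤ y →
      (1 + L)⁻¹ * (y - x) ≤ (y + t * w y) - (x + t * w x) := fun t ht x y hxy =>
    slope_lower_bound hL hLip hvw ht hxy
  obtain ⟨ψ, hψc, hψ⟩ := exists_continuous_inverse_flow hc hw hslope
  obtain ⟨Z, hZm, hZc, hZX⟩ := exists_continuous_version hXm hXc
  have hψt : ∀ t, Continuous (ψ t) := fun t =>
    hψc.comp (by fun_prop : Continuous fun x => (t, x))
  have hX0 : μ.map (X 0) = P := by
    have := congrArg (Measure.map Prod.fst) hend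
    rwa [Measure.map_map measurable_fst ((hXm 0 h0).prodMk (hXm 1 h1)), Measure.map_fst_prod,
      measure_univ, one_smul] at this
  have hX1 : μ.map (X 1) = P := by
    have := congrArg (Measure.map Prod.snd) hend
    rwa [Measure.map_map measurable_snd ((hXm 0 h0).prodMk (hXm 1 h1)), Measure.map_snd_prod,
      measure_univ, one_smul] at this
  let Y : ℝ → Ω → ℝ := fun t ω => ψ t (Z t ω)
  have hYm : ∀ t, Measurable (Y t) := fun t => (hψt t).measurable.comp (hZm t)
  have hYc : ∀ ω, Continuous fun t => Y t ω := fun ω =>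
    hψc.comp (continuous_id.prodMk (hZc ω))
  have hYX : ∀ᵐ ω ∂μ, ∀ t ∈ Icc (0 : ℝ) 1, Y t ω = ψ t (X t ω) := by
    filter_upwards [hZX] with ω hω t ht
    simp only [Y, hω t ht]
  have hlaw : ∀ t ∈ Icc (0 : ℝ) 1, μ.map (Y t) = P := by
    have hY0 : μ.map (Y 0) = P := by
      rw [← hX0]
      apply Measure.map_congr
      filter_upwards [hYX] with ω hω
      have := hψ 0 h0 (X 0 ω)
      rw [zero_mul, add_zero] at this
      rw [hω 0 h0, this]
    intro t ht
    rw [← hY0]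
    have := Measure.isProbabilityMeasure_map (μ := μ) (hYm t).aemeasurable
    have := Measure.isProbabilityMeasure_map (μ := μ) (hYm 0).aemeasurable
    refine measure_eq_of_integral_contDiff_eq fun g hg hgc => ?_
    rw [integral_map (hYm t).aemeasurable hg.continuous.aestronglyMeasurable,
      integral_map (hYm 0).aemeasurable hg.continuous.aestronglyMeasurable]
    have hcont : Continuous fun s => ∫ ω, g (Y s ω) ∂μ := by
      obtain ⟨C, hC⟩ := hgc.exists_bound_of_continuous hg.continuous
      exact continuous_of_dominated (bound := fun _ => C)
        (fun s => (hg.continuous.measurable.comp (hYm s)).aestronglyMeasurable)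
        (fun s => Eventually.of_forall fun ω => hC _) (integrable_const _)
        (Eventually.of_forall fun ω => hg.continuous.comp (hYc ω))
    -- The velocity is controlled only inside `(0,1)`, so constancy is obtained there and carried to
    -- the endpoints by continuity.
    have hhalf : EqOn (fun s => ∫ ω, g (Y s ω) ∂μ) (fun _ => ∫ ω, g (Y (1 / 2) ω) ∂μ)
        (Ioo 0 1) := by
      intro s hs
      have key := fun a b ha hab hb => integral_observable_label_eq (a := a) (b := b) hc hc1 ha hab
        hb hwLip hw hslope hvw hψc hψ hXm hvel hcond hYm hYc hYX hg hgc
      rcases le_total s (1 / 2) with h | h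
      · exact (key s (1 / 2) hs.1 h (by norm_num)).symm
      · exact key (1 / 2) s (by norm_num) h hs.2
    have hcl := hhalf.closure hcont continuous_const
    rw [closure_Ioo (zero_ne_one' ℝ)] at hcl
    exact (hcl ht).trans (hcl h0).symm
  obtain ⟨S, hS, hdisj, hsupp, hSpos, hcharge⟩ := hP
  have hmapψ : P.map (ψ 1) = P := by
    conv_rhs => rw [← hlaw 1 h1]
    rw [← hX1, Measure.map_map (hψt 1).measurable (hXm 1 h1)]
    apply Measure.map_congr
    filter_upwards [hYX] with ω hω using (hω 1 h1).symm
  have hmono : StrictMono fun x => x + 1 * w x := by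
    intro x y hxy
    have h2 := hslope 1 h1 x y hxy.le
    have h3 := mul_pos hc (sub_pos.2 hxy)
    simp only
    linarith
  have hfix : ∀ i, ∀ x ∈ S i, w x = 0 := by
    intro i x hx
    obtain ⟨ε, hε, hball⟩ := Metric.isOpen_iff.1 (hS i).1 x hx
    -- As `S i` is open, this gives `P` mass immediately on both sides of `x`; clipping at distance
    -- `ε / 2` keeps the intervals inside `S i`.
    have hmass : ∀ y z, y < z → Ioc y z ⊆ S i → 0 < P (Ioc y z) := fun y z hyz hsub =>
      hcharge i _ hsub measurableSet_Ioc (by simpa using hyz)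
    have := eq_of_map_eq_self (hψt 1).measurable hmono (hψ 1 h1) hmapψ (x := x)
      (fun y hy => (hmass x (min y (x + ε / 2)) (lt_min hy (by linarith)) fun z hz => hball (by
          rw [Metric.mem_ball, Real.dist_eq, abs_lt]
          constructor <;> linarith [hz.1, hz.2, min_le_right y (x + ε / 2)])).trans_le
        (measure_mono (Ioc_subset_Ioc_right (min_le_left _ _))))
      (fun y hy => (hmass (max y (x - ε / 2)) x (max_lt hy (by linarith)) fun z hz => hball (by
          rw [Metric.mem_ball, Real.dist_eq, abs_lt]
          constructor <;> linarith [hz.1, hz.2, le_max_right y (x - ε / 2)])).trans_le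
        (measure_mono (Ioc_subset_Ioc_left (le_max_left _ _))))
    linarith
  have hfixcl : ∀ x ∈ P.support, w x = 0 := by
    have hz : IsClosed {x | w x = 0} := isClosed_eq hw continuous_const
    rw [hsupp]
    rintro x (hx | hx)
    · exact closure_minimal (fun x hx => hfix 0 x hx) hz hx
    · exact closure_minimal (fun x hx => hfix 1 x hx) hz hx
  have hZmem : ∀ t ∈ Icc (0 : ℝ) 1, ∀ᵐ ω ∂μ, Z t ω ∈ closure (S 0) ∪ closure (S 1) := by
    intro t ht
    have hae : ∀ᵐ x ∂(μ.map (Y t)), x ∈ P.support := by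
      rw [hlaw t ht]
      exact Measure.support_mem_ae
    filter_upwards [ae_of_ae_map (hYm t).aemeasurable hae] with ω hω
    -- The label lies in the support, where `w = 0`, so the process coincides with its label.
    have h2 := hψ t ht (Z t ω)
    change Y t ω + t * w (Y t ω) = _ at h2
    rw [hfixcl _ hω, mul_zero, add_zero] at h2
    rwa [← hsupp, ← h2]
  have hcldisj : Disjoint (closure (S 0)) (closure (S 1)) :=
    hdisj.mono
      (closure_minimal subset_closedConvexHull isClosed_closedConvexHull)
      (closure_minimal subset_closedConvexHull isClosed_closedConvexHull)
  have hnot := ae_not_crossing_of_mem_union hZc isClosed_closure isClosed_closure hcldisj hZmem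
  have hpos : 0 < (P.prod P) (S 0 ×ˢ S 1) := by
    rw [Measure.prod_prod]
    exact ENNReal.mul_pos (hSpos 0).ne' (hSpos 1).ne'
  rw [← hend, Measure.map_apply ((hXm 0 h0).prodMk (hXm 1 h1))
    ((hS 0).1.measurableSet.prod (hS 1).1.measurableSet)] at hpos
  refine hpos.ne' (measure_eq_zero_iff_ae_notMem.2 ?_)
  filter_upwards [hnot, hZX] with ω hω hZω hmem
  apply hω
  rw [hZω 0 h0, hZω 1 h1]
  exact ⟨subset_closure hmem.1, subset_closure hmem.2⟩
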